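/- Let $\mathbb{T}^{\mathbb{N}}$ be the infinite-dimensional torus with its normalized Haar measure, and let $\mathfrak{p}_1<\mathfrak{p}_2<\dots$ be the sequence of primes. For a complex Banach space $X$ and $1\le p\le\infty$, let $H_p(\mathbb{T}^{\mathbb{N}},X)$ be the space of all $f\in L_p(\mathbb{T}^{\mathbb{N}},X)$ whose Fourier coefficients $\widehat f(\alpha)=\int_{\mathbb{T}^{\mathbb{N}}} f(\omega)\,\omega^{-\alpha}\,d\omega$ vanish for every finitely supported integer sequence $\alpha$ with at least one negative entry. Let $\mathcal{H}_p(X)$ be the space of all (formal) Dirichlet series $\sum_n a_n n^{-s}$ with coefficients $a_n\in X$ for which there is a (necessarily unique) $f\in H_p(\mathbb{T}^{\mathbb{N}},X)$ with $a_{\mathfrak{p}^{\alpha}}=\widehat f(\alpha)$ for all finitely supported sequences $\alpha$ of nonnegative integers, where $\mathfrak{p}^\alpha=\prod_j\mathfrak{p}_j^{\alpha_j}$, and put $\|\sum_n a_n n^{-s}\|_{\mathcal{H}_p(X)}=\|f\|_{L_p(\mathbb{T}^{\mathbb{N}},X)}$. For $D=\sum_n a_n n^{-s}$ and $\varepsilon>0$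 let $D_\varepsilon=\sum_n \frac{a_n}{n^{\varepsilon}} n^{-s}$, and let $\mathcal{H}_p^+(X)$ be the space of all Dirichlet series $D$ with coefficients in $X$ such that $D_\varepsilon\in\mathcal{H}_p(X)$ for every $\varepsilon>0$ and $\|D\|_{\mathcal{H}^+_p(X)}:=\sup_{\varepsilon>0}\|D_\varepsilon\|_{\mathcal{H}_p(X)}<\infty$. **Theorem.** There is a universal constant $C>0$ such that for every complex Banach space $X$, every $1\le p\le\infty$, every Dirichlet series $D=\sum_n a_n n^{-s}\in\mathcal{H}_p^+(X)$ and every real $x\ge 2$, the partial sum $\sum_{n\le x}a_n n^{-s}$ belongs to $\mathcal{H}_p^+(X)$ and $$\Big\|\sum_{n\le x}a_n n^{-s}\Big\|_{\mathcal{H}^+_p(X)}\le C\,\log x\;\|D\|_{\mathcal{H}^+_p(X)}.$$ -/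

import Mathlib

open MeasureTheory
open scoped ENNReal

noncomputable section

namespace HardyDirichlet

/-- `𝕋` carries its Borel `σ`-algebra. -/
instance instMeasurableSpaceCircle : MeasurableSpace Circle := borel Circle

instance instBorelSpaceCircle : BorelSpace Circle := ⟨rfl⟩

/-- The infinite-dimensional torus `𝕋^ℕ`, a compact abelian group, with the product
`σ`-algebra, which is its Borel `σ`-algebra. -/
abbrev InfTorus : Type := ℕ → Circle

/-- The normalized Haar measure on `𝕋^ℕ` (total mass `1`). -/
def torusHaar : Measure InfTorus := Measure.haarMeasure ⊤

/-- The character `ω ↦ ω^α` of `𝕋^ℕ` for a finitely supported integer sequence `α`. -/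
def torusMonomial (α : ℕ →₀ ℤ) (ω : InfTorus) : Circle :=
  α.prod fun j k => ω j ^ k

/-- The natural number `𝔭^α = 𝔭₁^α₁ 𝔭₂^α₂ ⋯`, where `𝔭` is the increasing sequence of primes. -/
def primePow (α : ℕ →₀ ℕ) : ℕ+ :=
  ⟨α.prod fun j k => Nat.nth Nat.Prime j ^ k,
    Finset.prod_pos fun j _ => pow_pos (Nat.prime_nth_prime j).pos _⟩

variable {X : Type*} [NormedAddCommGroup X] [NormedSpace ℂ X]

/-- The Fourier coefficient `∫ f(ω) ω^{-α} dω`. -/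
def torusFourierCoeff (f : InfTorus → X) (α : ℕ →₀ ℤ) : X :=
  ∫ ω, ((torusMonomial (-α) ω : Circle) : ℂ) • f ω ∂torusHaar

/-- `f` represents an element of the Hardy space `H_p(𝕋^ℕ, X)`: it belongs to `L_p(𝕋^ℕ, X)`, and
its Fourier coefficients vanish at every index that has a negative entry. -/
structure MemTorusHardy (f : InfTorus → X) (p : ℝ≥0∞) : Prop where
  memLp : MemLp f p torusHaar
  coeff_eq_zero : ∀ α : ℕ →₀ ℤ, (∃ j, α j < 0) → torusFourierCoeff f α = 0

/-- A (formal) Dirichlet series `∑ aₙ n^{-s}` with coefficients in `X`, given by `n ↦ aₙ`,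
`n ≥ 1`. -/
abbrev DirSeries (X : Type*) : Type _ := ℕ+ → X

/-- `f ∈ H_p(𝕋^ℕ, X)` corresponds to the Dirichlet series `D` under the Bohr transform:
the `α`-th Fourier coefficient of `f` is the coefficient of `D` at `𝔭^α`. -/
structure IsBohrLift (f : InfTorus → X) (D : DirSeries X) (p : ℝ≥0∞) : Prop where
  memTorusHardy : MemTorusHardy f p
  coeff_eq : ∀ α : ℕ →₀ ℕ,
    torusFourierCoeff f (α.mapRange (fun k : ℕ => (k : ℤ)) Nat.cast_zero) = D (primePow α)

/-- `D ∈ ℋ_p(X)`: `D` is the Bohr transform of some element of `H_p(𝕋^ℕ, X)`. -/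
def MemH (D : DirSeries X) (p : ℝ≥0∞) : Prop := ∃ f : InfTorus → X, IsBohrLift f D p

/-- The norm of `ℋ_p(X)` with values in `[0, ∞]`: the `L_p`-norm of the function corresponding to
`D` under the Bohr transform. This function is unique almost everywhere, being determined by its
Fourier coefficients, so the infimum only selects the norm of that function; it is `∞` if
`D ∉ ℋ_p(X)`. -/
def hENorm (D : DirSeries X) (p : ℝ≥0∞) : ℝ≥0∞ :=
  ⨅ (f : InfTorus → X) (_ : IsBohrLift f D p), eLpNorm f p torusHaar

/-- The translation `D_z = ∑ (aₙ / n^z) n^{-s}`. -/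
def dirTranslate (D : DirSeries X) (z : ℂ) : DirSeries X :=
  fun n => (1 / (n : ℂ) ^ z) • D n

/-- The norm of `ℋ⁺_p(X)` with values in `[0, ∞]`: the supremum over `ε > 0` of the
`ℋ_p(X)`-norms of the translations `D_ε`. -/
def hPlusENorm (D : DirSeries X) (p : ℝ≥0∞) : ℝ≥0∞ :=
  ⨆ (ε : ℝ) (_ : 0 < ε), hENorm (dirTranslate D (ε : ℂ)) p

/-- `D ∈ ℋ⁺_p(X)`: every translation `D_ε`, `ε > 0`, belongs to `ℋ_p(X)`, with bounded norms. -/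
structure MemHPlus (D : DirSeries X) (p : ℝ≥0∞) : Prop where
  translate_mem : ∀ ε : ℝ, 0 < ε → MemH (dirTranslate D (ε : ℂ)) p
  norm_lt_top : hPlusENorm D p < ∞

/-- The norm of `ℋ⁺_p(X)` as a real number, meaningful for `D` with `MemHPlus D p`. -/
def hPlusNorm (D : DirSeries X) (p : ℝ≥0∞) : ℝ := (hPlusENorm D p).toReal

/-- The partial sum `∑_{n ≤ x} aₙ n^{-s}`. -/
def partialSum (D : DirSeries X) (x : ℝ) : DirSeries X :=
  fun n => if ((n : ℕ) : ℝ) ≤ x then D n else 0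

end HardyDirichlet

end

/-! Truncation is a Fourier multiplier in the variable log n. With N = ⌊x⌋, a = log N and b =
log(N+1), no integer has its logarithm strictly between a and b, so the trapezoid equal to 1 on [-a,
a], 0 off [-b, b] and linear in between picks out exactly the terms n ≤ x. It is the Fourier
transform of an integrable kernel K, a difference of two Fejér kernels. On the torus the multiplier
is realised by averaging the Bohr lift with weight K along the Kronecker flow, whose eigenvalue on
the character of index α is governed by log 𝔭^α (`IsBohrLift.flowAverage`). The flow preserves Haar
measure, so Minkowski's inequality bounds the operator by ‖K‖₁ for every Banach space and every p
(`eLpNorm_flowAverage_le`). Finally ‖K‖₁ ≤ 6 + log(b/(b-a)) (`integral_abs_trapezoidKernel_le`), and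
b - a ≥ 1/(N+1) makes this O(log x). Truncation commutes with the translations D ↦ D_ε, so the bound
passes to the supremum over ε. -/

/-! ### Averages along a measure preserving flow. -/

section FlowAverage

variable {Ω : Type*} [MeasurableSpace Ω] {X : Type*} [NormedAddCommGroup X]

/-- A jointly measurable family of measure preserving maps gives a measure preserving shear. -/
theorem measurePreserving_shear {φ : ℝ → Ω → Ω} {μ : Measure Ω} [SFinite μ]
    (hφ : Measurable (Function.uncurry φ)) (hμ : ∀ t, MeasurePreserving (φ t) μ μ)
    (ν : Measure ℝ) [SFinite ν] :
    MeasurePreserving (fun z : ℝ × Ω => (z.1, φ z.1 z.2)) (ν.prod μ) (ν.prod μ) :=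
  (MeasurePreserving.id ν).skew_product hφ (.of_forall fun t => (hμ t).map_eq)

/-- Since `f` is only a.e. strongly measurable, composing it with the flow requires null sets of Ω
to pull back to null sets of the product. -/
theorem quasiMeasurePreserving_flow {φ : ℝ → Ω → Ω} {μ : Measure Ω} [SFinite μ]
    (hφ : Measurable (Function.uncurry φ)) (hμ : ∀ t, MeasurePreserving (φ t) μ μ)
    (ν : Measure ℝ) [SFinite ν] :
    Measure.QuasiMeasurePreserving (fun z : Ω × ℝ => φ z.2 z.1) (μ.prod ν) μ := by
  have h1 := (measurePreserving_shear hφ hμ ν).quasiMeasurePreserving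
  have h2 := (Measure.quasiMeasurePreserving_snd (μ := ν) (ν := μ)).comp h1
  exact h2.comp (Measure.measurePreserving_swap (μ := μ) (ν := ν)).quasiMeasurePreserving

variable [NormedSpace ℂ X]

/-- The average of `f` along the flow `φ` with weight `K`. -/
noncomputable def flowAverage (K : ℝ → ℂ) (φ : ℝ → Ω → Ω) (f : Ω → X) (ω : Ω) : X :=
  ∫ t, K t • f (φ t ω)

theorem aestronglyMeasurable_flowAverage {φ : ℝ → Ω → Ω} {μ : Measure Ω} [SFinite μ]
    (hφ : Measurable (Function.uncurry φ)) (hμ : ∀ t, MeasurePreserving (φ t) μ μ)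
    {K : ℝ → ℂ} (hK : AEStronglyMeasurable K) {f : Ω → X} (hf : AEStronglyMeasurable f μ) :
    AEStronglyMeasurable (flowAverage K φ f) μ :=
  AEStronglyMeasurable.integral_prod_right'
    (f := fun z : Ω × ℝ => K z.2 • f (φ z.2 z.1))
    ((hK.comp_quasiMeasurePreserving Measure.quasiMeasurePreserving_snd).smul
      (hf.comp_quasiMeasurePreserving (quasiMeasurePreserving_flow hφ hμ volume)))

theorem enorm_flowAverage_le {Ω : Type*} {K : ℝ → ℂ} (hK : Measurable K) (φ : ℝ → Ω → Ω)
    (f : Ω → X) (ω : Ω) :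
    ‖flowAverage K φ f ω‖ₑ ≤
      ∫⁻ t, ‖f (φ t ω)‖ₑ ∂(volume.withDensity fun t => ‖K t‖ₑ) := by
  rw [lintegral_withDensity_eq_lintegral_mul_non_measurable _ hK.enorm
    (.of_forall fun _ => enorm_lt_top)]
  refine (enorm_integral_le_lintegral_enorm _).trans (le_of_eq ?_)
  simp [enorm_smul]

/-- **Minkowski's inequality** for averages along a measure preserving flow. -/
theorem eLpNorm_flowAverage_le {φ : ℝ → Ω → Ω} {μ : Measure Ω} [SFinite μ]
    (hφ : Measurable (Function.uncurry φ)) (hμ : ∀ t, MeasurePreserving (φ t) μ μ)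
    {K : ℝ → ℂ} (hK : Measurable K) (hKi : Integrable K)
    {f : Ω → X} (hf : AEStronglyMeasurable f μ) {p : ℝ≥0∞} (hp : 1 ≤ p) :
    eLpNorm (flowAverage K φ f) p μ ≤ (∫⁻ t, ‖K t‖ₑ) * eLpNorm f p μ := by
  set ν : Measure ℝ := volume.withDensity fun t => ‖K t‖ₑ with hν
  have hM : ν Set.univ = ∫⁻ t, ‖K t‖ₑ := by simp [hν]
  have hfin : ∫⁻ t, ‖K t‖ₑ ≠ ∞ := hKi.2.ne
  have : IsFiniteMeasure ν := ⟨by rw [hM]; exact hKi.2⟩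
  have hq := quasiMeasurePreserving_flow hφ hμ ν
  have hle := enorm_flowAverage_le hK φ f
  rw [← hν] at hle
  rw [← hM]
  rcases eq_or_ne p ∞ with rfl | hptop
  · simp only [eLpNorm_exponent_top]
    refine essSup_le_of_ae_le _ ?_
    have h1 : ∀ᵐ ω ∂μ, ∀ᵐ t ∂ν, ‖f (φ t ω)‖ₑ ≤ eLpNormEssSup f μ :=
      Measure.ae_ae_of_ae_prod (hq.ae (ae_le_eLpNormEssSup (f := f) (μ := μ)))
    filter_upwards [h1] with ω hω
    refine (hle ω).trans ((lintegral_mono_ae hω).trans ?_)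
    simp [mul_comm]
  · have hp0 : p ≠ 0 := (zero_lt_one.trans_le hp).ne'
    have hr : 0 < p.toReal := ENNReal.toReal_pos hp0 hptop
    have hr1 : 1 ≤ p.toReal := by simpa using ENNReal.toReal_mono hptop hp
    have hmeas : AEStronglyMeasurable (fun z : Ω × ℝ => f (φ z.2 z.1)) (μ.prod ν) :=
      hf.comp_quasiMeasurePreserving hq
    have h1 : ∀ᵐ ω ∂μ, ‖flowAverage K φ f ω‖ₑ ^ p.toReal ≤
        (∫⁻ t, ‖f (φ t ω)‖ₑ ^ p.toReal ∂ν) * ν Set.univ ^ (p.toReal - 1) := by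
      filter_upwards [hmeas.prodMk_left] with ω hω
      -- Hölder on the finite measure |K| dt; raising to the power p leaves the factor ‖K‖₁^(p-1),
      -- and Tonelli with invariance of μ supplies the remaining ‖K‖₁.
      have h2 := eLpNorm_le_eLpNorm_mul_rpow_measure_univ hp hω
      rw [eLpNorm_one_eq_lintegral_enorm] at h2
      have h3 := ENNReal.rpow_le_rpow ((hle ω).trans h2) hr.le
      refine h3.trans (le_of_eq ?_)
      rw [ENNReal.mul_rpow_of_nonneg _ _ hr.le, eLpNorm_eq_lintegral_rpow_enorm_toReal hp0 hptop,
        ← ENNReal.rpow_mul, ← ENNReal.rpow_mul]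
      congr 2
      · simp [hr.ne']
      · simp only [ENNReal.toReal_one]; field_simp
    have h4 : ∫⁻ ω, ∫⁻ t, ‖f (φ t ω)‖ₑ ^ p.toReal ∂ν ∂μ =
        ν Set.univ * ∫⁻ ω, ‖f ω‖ₑ ^ p.toReal ∂μ := by
      rw [lintegral_lintegral_swap (by exact hmeas.enorm.pow_const _)]
      have : ∀ t, ∫⁻ ω, ‖f (φ t ω)‖ₑ ^ p.toReal ∂μ = ∫⁻ ω, ‖f ω‖ₑ ^ p.toReal ∂μ := by
        intro t
        have h5 : AEMeasurable (fun ω => ‖f ω‖ₑ ^ p.toReal) (μ.map (φ t)) := by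
          rw [(hμ t).map_eq]; exact hf.enorm.pow_const _
        have h6 := lintegral_map' h5 (hμ t).measurable.aemeasurable
        rw [(hμ t).map_eq] at h6
        exact h6.symm
      simp only [this, lintegral_const, mul_comm]
    rw [eLpNorm_eq_lintegral_rpow_enorm_toReal hp0 hptop,
      eLpNorm_eq_lintegral_rpow_enorm_toReal hp0 hptop]
    have h7 : ∫⁻ ω, ‖flowAverage K φ f ω‖ₑ ^ p.toReal ∂μ ≤
        ν Set.univ ^ p.toReal * ∫⁻ ω, ‖f ω‖ₑ ^ p.toReal ∂μ := by
      refine (lintegral_mono_ae h1).trans (le_of_eq ?_)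
      rw [lintegral_mul_const' _ _
        (ENNReal.rpow_ne_top_of_nonneg (by linarith) (measure_ne_top _ _)), h4, mul_right_comm]
      congr 1
      nth_rewrite 1 [← ENNReal.rpow_one (ν Set.univ)]
      rw [← ENNReal.rpow_add_of_nonneg _ _ zero_le_one (by linarith)]
      congr 1; ring
    refine (ENNReal.rpow_le_rpow h7 (by positivity)).trans (le_of_eq ?_)
    rw [ENNReal.mul_rpow_of_nonneg _ _ (by positivity), ← ENNReal.rpow_mul]
    simp [hr.ne']

theorem memLp_flowAverage {φ : ℝ → Ω → Ω} {μ : Measure Ω} [SFinite μ]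
    (hφ : Measurable (Function.uncurry φ)) (hμ : ∀ t, MeasurePreserving (φ t) μ μ)
    {K : ℝ → ℂ} (hK : Measurable K) (hKi : Integrable K)
    {f : Ω → X} {p : ℝ≥0∞} (hf : MemLp f p μ) (hp : 1 ≤ p) :
    MemLp (flowAverage K φ f) p μ :=
  ⟨aestronglyMeasurable_flowAverage hφ hμ hK.aestronglyMeasurable hf.1,
    (eLpNorm_flowAverage_le hφ hμ hK hKi hf.1 hp).trans_lt (ENNReal.mul_lt_top hKi.2 hf.2)⟩

/-- If `χ` is an eigenfunction of the inverse flow, averaging along the flow multiplies the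
pairing with `χ` by the integral of the weight against the eigenvalues. -/
theorem integral_smul_flowAverage [CompleteSpace X] {φ : ℝ → Ω → Ω} {μ : Measure Ω} [SFinite μ]
    (hφ : Measurable (Function.uncurry φ)) (hμ : ∀ t, MeasurePreserving (φ t) μ μ)
    {K : ℝ → ℂ} (hKi : Integrable K) {f : Ω → X} (hf : Integrable f μ)
    {χ : Ω → ℂ} (hχ : Measurable χ) (hχ1 : ∀ ω, ‖χ ω‖ ≤ 1) {e : ℝ → ℂ}
    (he : ∀ t ω, χ ω = e t * χ (φ t ω)) :
    ∫ ω, χ ω • flowAverage K φ f ω ∂μ = (∫ t, e t * K t) • ∫ ω, χ ω • f ω ∂μ := by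
  -- The integrand is K ⊗ f composed with the measure preserving shear, which justifies Fubini
  -- below.
  have hint : Integrable (fun z : ℝ × Ω => K z.1 • f (φ z.1 z.2)) (volume.prod μ) :=
    ((measurePreserving_shear hφ hμ volume).integrable_comp
      (hKi.smul_prod hf).aestronglyMeasurable).2 (hKi.smul_prod hf)
  have hint2 : Integrable (fun z : ℝ × Ω => χ z.2 • K z.1 • f (φ z.1 z.2)) (volume.prod μ) :=
    hint.bdd_smul 1 (hχ.comp measurable_snd).aestronglyMeasurable
      (.of_forall fun z => hχ1 z.2)
  have hχf : AEStronglyMeasurable (fun ω => χ ω • f ω) μ :=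
    hχ.aestronglyMeasurable.smul hf.aestronglyMeasurable
  calc ∫ ω, χ ω • flowAverage K φ f ω ∂μ
      = ∫ ω, (∫ t, χ ω • K t • f (φ t ω)) ∂μ := by simp only [flowAverage, integral_smul]
    _ = ∫ t, ∫ ω, χ ω • K t • f (φ t ω) ∂μ := (integral_integral_swap hint2).symm
    _ = ∫ t, (e t * K t) • ∫ ω, χ ω • f ω ∂μ := by
        refine integral_congr_ae (.of_forall fun t => ?_)
        have h1 : ∀ ω, χ ω • K t • f (φ t ω) = (e t * K t) • (χ (φ t ω) • f (φ t ω)) := by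
          intro ω; rw [he t ω]; simp only [smul_smul]; congr 1; ring
        have h2 : ∫ ω, χ (φ t ω) • f (φ t ω) ∂μ = ∫ ω, χ ω • f ω ∂μ := by
          have h3 : AEStronglyMeasurable (fun ω => χ ω • f ω) (μ.map (φ t)) := by
            rwa [(hμ t).map_eq]
          have h4 := integral_map (hμ t).measurable.aemeasurable h3
          rw [(hμ t).map_eq] at h4
          exact h4.symm
        simp only [h1, integral_smul, h2]
    _ = _ := integral_smul_const _ _

end FlowAverage

/-! ### The trapezoid multiplier and the L¹-norm of its kernel. -/

section TrapezoidKernel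

open Real FourierTransform

/-- The Fejér-type kernel, the Fourier transform of the triangle function `u ↦ max 0 (c - |u|)`. -/
noncomputable def fejerKernel (c t : ℝ) : ℝ := (1 - cos (2 * π * c * t)) / (2 * π ^ 2 * t ^ 2)

theorem measurable_fejerKernel (c : ℝ) : Measurable (fejerKernel c) := by
  unfold fejerKernel; fun_prop

theorem fejerKernel_nonneg (c t : ℝ) : 0 ≤ fejerKernel c t :=
  div_nonneg (sub_nonneg.2 (cos_le_one _)) (by positivity)

theorem integrable_fejerKernel (c : ℝ) : Integrable (fejerKernel c) := by
  refine (integrable_inv_one_add_sq.const_mul (c ^ 2 + 1)).mono'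
    (measurable_fejerKernel c).aestronglyMeasurable (.of_forall fun t => ?_)
  rw [norm_of_nonneg (fejerKernel_nonneg c t)]
  rcases eq_or_ne t 0 with rfl | ht
  · simp [fejerKernel]; positivity
  · have h1 : 1 - cos (2 * π * c * t) ≤ 2 * π ^ 2 * t ^ 2 * c ^ 2 := by
      have := one_sub_sq_div_two_le_cos (x := 2 * π * c * t)
      nlinarith
    have h2 : 1 - cos (2 * π * c * t) ≤ 2 * π ^ 2 := by
      have := neg_one_le_cos (2 * π * c * t)
      nlinarith [pi_gt_three]
    have ht2 : 0 < t ^ 2 := by positivity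
    unfold fejerKernel
    rw [← div_eq_mul_inv, div_le_div_iff₀ (by positivity) (by positivity)]
    nlinarith

theorem hasDerivAt_linear_mul_cexp (c : ℂ) {z : ℂ} (hz : z ≠ 0) (v : ℝ) :
    HasDerivAt (fun v : ℝ => ((c - v) / z + 1 / z ^ 2) * Complex.exp (z * v))
      (Complex.exp (z * v) * (c - v)) v := by
  have h0 : HasDerivAt (fun v : ℝ => (v : ℂ)) 1 v := Complex.ofRealCLM.hasDerivAt
  have h1 := (((h0.const_sub c).div_const z).add_const (1 / z ^ 2)).mul
    ((h0.const_mul z).cexp)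
  convert! h1 using 1
  field_simp
  ring

theorem integral_cexp_mul_linear (c : ℝ) {z : ℂ} (hz : z ≠ 0) :
    ∫ v in (0 : ℝ)..c, Complex.exp (z * v) * ((c : ℂ) - v) =
      Complex.exp (z * c) / z ^ 2 - c / z - 1 / z ^ 2 := by
  rw [intervalIntegral.integral_eq_sub_of_hasDerivAt
    (fun v _ => hasDerivAt_linear_mul_cexp (c : ℂ) hz v)
    (Continuous.intervalIntegrable (by fun_prop) _ _)]
  simp
  ring

theorem continuous_triangle (c : ℝ) : Continuous fun u : ℝ => ((max 0 (c - |u|) : ℝ) : ℂ) := by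
  fun_prop

theorem triangle_eq_zero {c u : ℝ} (hu : u ∉ Set.Ioc (-c) c) : max 0 (c - |u|) = 0 := by
  refine max_eq_left ?_
  by_contra! h
  have := abs_lt.1 (show |u| < c by linarith)
  exact hu ⟨this.1, this.2.le⟩

theorem integrable_triangle (c : ℝ) : Integrable fun u : ℝ => ((max 0 (c - |u|) : ℝ) : ℂ) := by
  have h : IntegrableOn (fun u : ℝ => ((max 0 (c - |u|) : ℝ) : ℂ)) (Set.Ioc (-c) c) :=
    ((continuous_triangle c).integrableOn_Icc (a := -c) (b := c)).mono_set Set.Ioc_subset_Icc_self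
  exact (integrableOn_iff_integrable_of_support_subset fun u hu => by
    by_contra h'; exact hu (by simp [triangle_eq_zero h'])).1 h

/-- The point t = 0 is excluded because division by zero gives `fejerKernel c 0 = 0`, while the
transform there is c². Fourier inversion only needs equality almost everywhere. -/
theorem fourier_triangle {c : ℝ} (hc : 0 ≤ c) {t : ℝ} (ht : t ≠ 0) :
    𝓕 (fun u : ℝ => ((max 0 (c - |u|) : ℝ) : ℂ)) t = (fejerKernel c t : ℂ) := by
  set z : ℂ := -(2 * π * t * Complex.I) with hz
  have hπ : (π : ℂ) ≠ 0 := by exact_mod_cast pi_ne_zero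
  have ht' : (t : ℂ) ≠ 0 := by exact_mod_cast ht
  have hz0 : z ≠ 0 := by simp [hz, hπ, ht']
  have hcont : Continuous fun v : ℝ => Complex.exp (z * v) * ((max 0 (c - |v|) : ℝ) : ℂ) := by
    fun_prop
  have h1 : 𝓕 (fun u : ℝ => ((max 0 (c - |u|) : ℝ) : ℂ)) t =
      ∫ v in (-c)..c, Complex.exp (z * v) * ((max 0 (c - |v|) : ℝ) : ℂ) := by
    rw [Real.fourier_eq', intervalIntegral.integral_of_le (by linarith),
      setIntegral_eq_integral_of_forall_compl_eq_zero
        (fun v hv => by rw [triangle_eq_zero hv]; simp)]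
    refine integral_congr_ae (.of_forall fun v => ?_)
    simp only [smul_eq_mul, hz]
    congr 2
    simp
    ring
  have h2 : ∫ v in (0 : ℝ)..c, Complex.exp (z * v) * ((max 0 (c - |v|) : ℝ) : ℂ) =
      Complex.exp (z * c) / z ^ 2 - c / z - 1 / z ^ 2 := by
    rw [← integral_cexp_mul_linear c hz0]
    refine intervalIntegral.integral_congr fun v hv => ?_
    rw [Set.uIcc_of_le hc] at hv
    simp only [abs_of_nonneg hv.1, max_eq_right (sub_nonneg.2 hv.2)]
    push_cast; rfl
  have h3 : ∫ v in (-c)..0, Complex.exp (z * v) * ((max 0 (c - |v|) : ℝ) : ℂ) =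
      Complex.exp (-z * c) / (-z) ^ 2 - c / (-z) - 1 / (-z) ^ 2 := by
    rw [← integral_cexp_mul_linear c (neg_ne_zero.2 hz0),
      ← neg_zero, ← intervalIntegral.integral_comp_neg, neg_zero]
    refine intervalIntegral.integral_congr fun v hv => ?_
    rw [Set.uIcc_of_le hc] at hv
    simp only [abs_neg, abs_of_nonneg hv.1, max_eq_right (sub_nonneg.2 hv.2)]
    push_cast; simp
  rw [h1, ← intervalIntegral.integral_add_adjacent_intervals (hcont.intervalIntegrable _ 0)
    (hcont.intervalIntegrable 0 _), h2, h3]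
  have h4 : Complex.exp (z * c) + Complex.exp (-z * c) = 2 * Complex.cos (2 * π * c * t) := by
    rw [Complex.two_cos, add_comm]
    congr 2 <;> · rw [hz]; ring
  have h5 : z ^ 2 = -(4 * π ^ 2 * t ^ 2) := by
    rw [hz, neg_sq, mul_pow, Complex.I_sq]; ring
  have h6 : Complex.exp (-z * c) / (-z) ^ 2 - c / (-z) - 1 / (-z) ^ 2 +
      (Complex.exp (z * c) / z ^ 2 - c / z - 1 / z ^ 2) =
      (Complex.exp (z * c) + Complex.exp (-z * c) - 2) / z ^ 2 := by
    field_simp; ring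
  rw [h6, h4, h5, fejerKernel]
  push_cast
  field_simp
  ring

theorem integral_cexp_mul_fejerKernel {c : ℝ} (hc : 0 ≤ c) (u : ℝ) :
    ∫ t : ℝ, Complex.exp (2 * π * t * u * Complex.I) * (fejerKernel c t : ℂ) =
      ((max 0 (c - |u|) : ℝ) : ℂ) := by
  have hae : 𝓕 (fun u : ℝ => ((max 0 (c - |u|) : ℝ) : ℂ)) =ᵐ[volume]
      fun t => (fejerKernel c t : ℂ) := by
    filter_upwards [Measure.ae_ne volume (0 : ℝ)] with t ht using fourier_triangle hc ht
  have h := congrFun (Continuous.fourierInv_fourier_eq (continuous_triangle c)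
    (integrable_triangle c) ((integrable_fejerKernel c).ofReal.congr hae.symm)) u
  rw [← h, Real.fourierInv_eq']
  refine integral_congr_ae ?_
  filter_upwards [hae] with t ht
  rw [ht, smul_eq_mul]
  congr 2
  simp
  ring

/-- The kernel whose Fourier transform is the trapezoid function that is `1` on `[-a, a]` and `0`
outside `[-b, b]`. -/
noncomputable def trapezoidKernel (a b t : ℝ) : ℝ := (fejerKernel b t - fejerKernel a t) / (b - a)

theorem measurable_trapezoidKernel (a b : ℝ) : Measurable (trapezoidKernel a b) :=
  ((measurable_fejerKernel b).sub (measurable_fejerKernel a)).div_const _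

theorem integrable_trapezoidKernel (a b : ℝ) : Integrable (trapezoidKernel a b) :=
  ((integrable_fejerKernel b).sub (integrable_fejerKernel a)).div_const _

/-- A trapezoid is the difference of two triangles with parallel sides, divided by the gap b - a. -/
theorem integral_cexp_mul_trapezoidKernel {a b : ℝ} (ha : 0 ≤ a) (hab : a < b) (u : ℝ) :
    ∫ t : ℝ, Complex.exp (2 * π * t * u * Complex.I) * (trapezoidKernel a b t : ℂ) =
      (((max 0 (b - |u|) - max 0 (a - |u|)) / (b - a) : ℝ) : ℂ) := by
  have hint : ∀ c : ℝ, Integrable fun t : ℝ =>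
      Complex.exp (2 * π * t * u * Complex.I) * (fejerKernel c t : ℂ) := fun c =>
    (integrable_fejerKernel c).ofReal.bdd_mul (c := 1)
      (Continuous.aestronglyMeasurable (by fun_prop)) (.of_forall fun t => by
        have : (2 * π * t * u * Complex.I : ℂ) = ((2 * π * t * u : ℝ) : ℂ) * Complex.I := by
          push_cast; rfl
        rw [this, Complex.norm_exp_ofReal_mul_I])
  have h1 : ∀ t : ℝ, Complex.exp (2 * π * t * u * Complex.I) * (trapezoidKernel a b t : ℂ) =
      (Complex.exp (2 * π * t * u * Complex.I) * (fejerKernel b t : ℂ) -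
        Complex.exp (2 * π * t * u * Complex.I) * (fejerKernel a t : ℂ)) / ((b - a : ℝ) : ℂ) := by
    intro t; simp only [trapezoidKernel]; push_cast; ring
  simp only [h1]
  rw [integral_div, integral_sub (hint b) (hint a), integral_cexp_mul_fejerKernel (by linarith),
    integral_cexp_mul_fejerKernel ha]
  push_cast; rfl

theorem abs_cos_sub_cos_le_mul (x y : ℝ) : |cos x - cos y| ≤ |x + y| * |x - y| / 2 := by
  have h1 : |sin ((x + y) / 2)| ≤ |x + y| / 2 :=
    abs_sin_le_abs.trans_eq (by rw [abs_div]; simp)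
  have h2 : |sin ((x - y) / 2)| ≤ |x - y| / 2 :=
    abs_sin_le_abs.trans_eq (by rw [abs_div]; simp)
  calc |cos x - cos y| = 2 * |sin ((x + y) / 2)| * |sin ((x - y) / 2)| := by
        rw [cos_sub_cos, abs_mul, abs_mul]; simp
    _ ≤ 2 * (|x + y| / 2) * (|x - y| / 2) := by gcongr
    _ = _ := by ring

theorem abs_trapezoidKernel {a b : ℝ} (hab : a < b) (t : ℝ) :
    |trapezoidKernel a b t| =
      |cos (2 * π * a * t) - cos (2 * π * b * t)| / (2 * π ^ 2 * (b - a) * t ^ 2) := by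
  have h : trapezoidKernel a b t =
      (cos (2 * π * a * t) - cos (2 * π * b * t)) / (2 * π ^ 2 * (b - a) * t ^ 2) := by
    simp only [trapezoidKernel, fejerKernel, ← sub_div, div_div]
    congr 1 <;> ring
  have hba : 0 < b - a := sub_pos.2 hab
  rw [h, abs_div, abs_of_nonneg (a := 2 * π ^ 2 * (b - a) * t ^ 2) (by positivity)]

/-- Writing the difference of cosines as a product of sines yields a factor b - a that cancels the
denominator. This bound serves t ≤ 1/b; the next two serve 1/b < t ≤ 1/(b-a) and t > 1/(b-a), and
only the middle range contributes a logarithm. -/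
theorem abs_trapezoidKernel_le_const {a b t : ℝ} (ha : 0 ≤ a) (hab : a < b) (ht : 0 < t) :
    |trapezoidKernel a b t| ≤ 2 * b := by
  have hba : 0 < b - a := sub_pos.2 hab
  have hb : 0 < b := by linarith
  rw [abs_trapezoidKernel hab, div_le_iff₀ (by positivity)]
  refine (abs_cos_sub_cos_le_mul _ _).trans ?_
  have h1 : |2 * π * a * t + 2 * π * b * t| = 2 * π * t * (a + b) := by
    rw [abs_of_nonneg (by positivity)]; ring
  have h2 : |2 * π * a * t - 2 * π * b * t| = 2 * π * t * (b - a) := by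
    rw [abs_sub_comm, abs_of_nonneg (by
      have : 0 ≤ 2 * π * t * (b - a) := by positivity
      linarith)]
    ring
  rw [h1, h2]
  have : 2 * b * (2 * π ^ 2 * (b - a) * t ^ 2) -
      2 * π * t * (a + b) * (2 * π * t * (b - a)) / 2 = 2 * π ^ 2 * t ^ 2 * (b - a) ^ 2 := by ring
  have : 0 ≤ 2 * π ^ 2 * t ^ 2 * (b - a) ^ 2 := by positivity
  linarith

theorem abs_trapezoidKernel_le_inv {a b t : ℝ} (hab : a < b) (ht : 0 < t) :
    |trapezoidKernel a b t| ≤ t⁻¹ / 2 := by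
  have hba : 0 < b - a := sub_pos.2 hab
  rw [abs_trapezoidKernel hab, div_le_iff₀ (by positivity)]
  refine (Real.abs_cos_sub_cos_le _ _).trans ?_
  have h2 : |2 * π * a * t - 2 * π * b * t| = 2 * π * t * (b - a) := by
    rw [abs_sub_comm, abs_of_nonneg (by
      have : 0 ≤ 2 * π * t * (b - a) := by positivity
      linarith)]
    ring
  have h3 : t⁻¹ / 2 * (2 * π ^ 2 * (b - a) * t ^ 2) = π * (π * t * (b - a)) := by
    field_simp
  rw [h2, h3]
  have : 0 < π * t * (b - a) := by positivity
  nlinarith [pi_gt_three]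

theorem abs_trapezoidKernel_le_inv_sq {a b t : ℝ} (hab : a < b) (ht : 0 < t) :
    |trapezoidKernel a b t| ≤ (b - a)⁻¹ * t ^ (-2 : ℝ) := by
  have hba : 0 < b - a := sub_pos.2 hab
  rw [abs_trapezoidKernel hab, div_le_iff₀ (by positivity), rpow_neg ht.le, rpow_two]
  have h3 : (b - a)⁻¹ * (t ^ 2)⁻¹ * (2 * π ^ 2 * (b - a) * t ^ 2) = 2 * π ^ 2 := by
    field_simp
  rw [h3]
  have h4 : |cos (2 * π * a * t) - cos (2 * π * b * t)| ≤ 2 := by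
    rw [abs_le]
    constructor <;> linarith [neg_one_le_cos (2 * π * a * t), neg_one_le_cos (2 * π * b * t),
      cos_le_one (2 * π * a * t), cos_le_one (2 * π * b * t)]
  nlinarith [pi_gt_three]

/-- The `L¹`-norm of the trapezoid kernel grows only logarithmically as the gap `b - a` closes. -/
theorem integral_abs_trapezoidKernel_le {a b : ℝ} (ha : 0 ≤ a) (hab : a < b) :
    ∫ t, |trapezoidKernel a b t| ≤ 6 + log (b / (b - a)) := by
  have hba : 0 < b - a := sub_pos.2 hab
  have hb : 0 < b := by linarith
  have hi : Integrable fun t => |trapezoidKernel a b t| := (integrable_trapezoidKernel a b).abs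
  have hp : 0 < 1 / b := by positivity
  have hpq : 1 / b ≤ 1 / (b - a) := one_div_le_one_div_of_le hba (by linarith)
  have hq : 0 < 1 / (b - a) := by positivity
  have heven : ∫ t, |trapezoidKernel a b t| = 2 * ∫ t in Set.Ioi 0, |trapezoidKernel a b t| := by
    rw [← integral_comp_abs (f := fun t => |trapezoidKernel a b t|)]
    refine integral_congr_ae (.of_forall fun t => ?_)
    rcases abs_choice t with h | h <;> simp [h, abs_trapezoidKernel hab]
  have h1 : ∫ t in Set.Ioc 0 (1 / b), |trapezoidKernel a b t| ≤ 2 := by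
    calc ∫ t in Set.Ioc 0 (1 / b), |trapezoidKernel a b t|
        ≤ ∫ t in Set.Ioc 0 (1 / b), 2 * b := by
          refine setIntegral_mono_on hi.integrableOn
            (integrableOn_const measure_Ioc_lt_top.ne) measurableSet_Ioc fun t ht => ?_
          exact abs_trapezoidKernel_le_const ha hab ht.1
      _ = 2 := by simp [hb.le]; field_simp
  have h2 : ∫ t in Set.Ioc (1 / b) (1 / (b - a)), |trapezoidKernel a b t| ≤
      log (b / (b - a)) / 2 := by
    have h0 : (0 : ℝ) ∉ Set.uIcc (1 / b) (1 / (b - a)) := by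
      rw [Set.uIcc_of_le hpq]; exact fun h => absurd h.1 (not_le.2 hp)
    calc ∫ t in Set.Ioc (1 / b) (1 / (b - a)), |trapezoidKernel a b t|
        ≤ ∫ t in Set.Ioc (1 / b) (1 / (b - a)), t⁻¹ / 2 := by
          refine setIntegral_mono_on hi.integrableOn ?_ measurableSet_Ioc fun t ht => ?_
          · rw [← intervalIntegrable_iff_integrableOn_Ioc_of_le hpq]
            exact (intervalIntegral.intervalIntegrable_inv
              (fun x hx => ne_of_mem_of_not_mem hx h0) continuousOn_id).div_const _
          · exact abs_trapezoidKernel_le_inv hab (hp.trans ht.1)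
      _ = log (b / (b - a)) / 2 := by
          rw [← intervalIntegral.integral_of_le hpq, intervalIntegral.integral_div,
            integral_inv h0]
          congr 2
          field_simp
  have h3 : ∫ t in Set.Ioi (1 / (b - a)), |trapezoidKernel a b t| ≤ 1 := by
    calc ∫ t in Set.Ioi (1 / (b - a)), |trapezoidKernel a b t|
        ≤ ∫ t in Set.Ioi (1 / (b - a)), (b - a)⁻¹ * t ^ (-2 : ℝ) := by
          refine setIntegral_mono_on hi.integrableOn
            ((integrableOn_Ioi_rpow_of_lt (by norm_num) hq).const_mul _) measurableSet_Ioi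
            fun t ht => ?_
          exact abs_trapezoidKernel_le_inv_sq hab (hq.trans ht)
      _ = 1 := by
          rw [integral_const_mul, integral_Ioi_rpow_of_lt (by norm_num) hq]
          norm_num [rpow_neg_one]
          field_simp
          ring
  have hsplit : ∫ t in Set.Ioi 0, |trapezoidKernel a b t| =
      (∫ t in Set.Ioc 0 (1 / b), |trapezoidKernel a b t|) +
        ((∫ t in Set.Ioc (1 / b) (1 / (b - a)), |trapezoidKernel a b t|) +
          ∫ t in Set.Ioi (1 / (b - a)), |trapezoidKernel a b t|) := by
    rw [← setIntegral_union (Set.Ioc_disjoint_Ioi le_rfl) measurableSet_Ioi hi.integrableOn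
      hi.integrableOn, Set.Ioc_union_Ioi_eq_Ioi hpq,
      ← setIntegral_union (Set.Ioc_disjoint_Ioi le_rfl) measurableSet_Ioi hi.integrableOn
      hi.integrableOn, Set.Ioc_union_Ioi_eq_Ioi hp.le]
  rw [heven, hsplit]
  linarith

end TrapezoidKernel

/-! ### The Kronecker flow and multipliers of Dirichlet series. -/

namespace HardyDirichlet

instance isHaarMeasure_torusHaar : torusHaar.IsHaarMeasure := by
  unfold torusHaar; infer_instance

instance isProbabilityMeasure_torusHaar : IsProbabilityMeasure torusHaar :=
  ⟨by
    simpa [torusHaar] using Measure.haarMeasure_self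
      (K₀ := (⊤ : TopologicalSpace.PositiveCompacts InfTorus))⟩

/-- The point `(𝔭ⱼ^{2πit})ⱼ` of the infinite torus. -/
noncomputable def kroneckerPoint (t : ℝ) : InfTorus :=
  fun j => Circle.exp (2 * Real.pi * t * Real.log (Nat.nth Nat.Prime j))

/-- The Kronecker flow on the infinite torus. -/
noncomputable def kroneckerFlow (t : ℝ) (ω : InfTorus) : InfTorus := kroneckerPoint t * ω

theorem measurable_kroneckerFlow : Measurable (Function.uncurry kroneckerFlow) := by
  refine Continuous.measurable (continuous_pi fun j => ?_)
  simp only [Function.uncurry, kroneckerFlow, kroneckerPoint, Pi.mul_apply]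
  fun_prop

theorem measurePreserving_kroneckerFlow (t : ℝ) :
    MeasurePreserving (kroneckerFlow t) torusHaar torusHaar :=
  measurePreserving_mul_left torusHaar (kroneckerPoint t)

theorem continuous_torusMonomial (α : ℕ →₀ ℤ) : Continuous (torusMonomial α) := by
  unfold torusMonomial Finsupp.prod
  exact continuous_finsetProd _ fun j _ => (continuous_apply j).zpow _

theorem torusMonomial_mul (α : ℕ →₀ ℤ) (ω η : InfTorus) :
    torusMonomial α (ω * η) = torusMonomial α ω * torusMonomial α η := by
  simp only [torusMonomial, Pi.mul_apply, mul_zpow, Finsupp.prod_mul]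

theorem torusMonomial_neg (α : ℕ →₀ ℤ) (ω : InfTorus) :
    torusMonomial (-α) ω = (torusMonomial α ω)⁻¹ := by
  simp [torusMonomial, Finsupp.prod, Finsupp.support_neg]

/-- The frequency of the character `ω ↦ ω^α` along the Kronecker flow, i.e. `log 𝔭^α`. -/
noncomputable def frequency (α : ℕ →₀ ℤ) : ℝ :=
  α.sum fun j k => k * Real.log (Nat.nth Nat.Prime j)

theorem torusMonomial_kroneckerPoint (α : ℕ →₀ ℤ) (t : ℝ) :
    torusMonomial α (kroneckerPoint t) = Circle.exp (2 * Real.pi * t * frequency α) := by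
  simp only [torusMonomial, kroneckerPoint, frequency, Finsupp.prod, Finsupp.sum, Finset.mul_sum]
  induction α.support using Finset.cons_induction with
  | empty => simp
  | cons j s hj ih =>
    rw [Finset.prod_cons, Finset.sum_cons, Circle.exp_add, ih, ← Circle.exp_intCast_mul]
    congr 2
    ring

/-- This is what turns a multiplier in the frequency into a multiplier in log n. -/
theorem frequency_natCast (α : ℕ →₀ ℕ) :
    frequency (α.mapRange (fun k : ℕ => (k : ℤ)) Nat.cast_zero) =
      Real.log ((primePow α : ℕ) : ℝ) := by
  rw [frequency, Finsupp.sum_mapRange_index (by simp)]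
  simp only [primePow, PNat.mk_coe, Finsupp.prod, Finsupp.sum]
  push_cast
  rw [Real.log_prod (fun j _ => pow_ne_zero _ (by
    exact_mod_cast (Nat.prime_nth_prime j).ne_zero))]
  simp

variable {X : Type*} [NormedAddCommGroup X] [NormedSpace ℂ X] [CompleteSpace X]

theorem torusFourierCoeff_flowAverage {K : ℝ → ℂ} (hK : Integrable K) {f : InfTorus → X}
    (hf : Integrable f torusHaar) (α : ℕ →₀ ℤ) :
    torusFourierCoeff (flowAverage K kroneckerFlow f) α =
      (∫ t : ℝ, Complex.exp (2 * Real.pi * t * frequency α * Complex.I) * K t) •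
        torusFourierCoeff f α := by
  refine integral_smul_flowAverage measurable_kroneckerFlow measurePreserving_kroneckerFlow hK hf
    (Continuous.measurable ?_)
    (fun ω => (Circle.norm_coe _).le) fun t ω => ?_
  · exact continuous_subtype_val.comp (continuous_torusMonomial _)
  · have h := torusMonomial_kroneckerPoint α t
    have h1 : torusMonomial (-α) ω =
        Circle.exp (2 * Real.pi * t * frequency α) * torusMonomial (-α) (kroneckerFlow t ω) := by
      rw [kroneckerFlow, torusMonomial_mul, torusMonomial_neg α (kroneckerPoint t), h,
        mul_inv_cancel_left]
    rw [h1]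
    simp

/-- Averaging along the Kronecker flow acts on Dirichlet series as a multiplier. -/
theorem IsBohrLift.flowAverage {f : InfTorus → X} {D : DirSeries X} {p : ℝ≥0∞}
    (hf : IsBohrLift f D p) (hp : 1 ≤ p) {K : ℝ → ℂ} (hKm : Measurable K) (hK : Integrable K) :
    IsBohrLift (flowAverage K kroneckerFlow f)
      (fun n => (∫ t : ℝ, Complex.exp (2 * Real.pi * t * Real.log (n : ℕ) * Complex.I) * K t) •
        D n) p := by
  have hfi := hf.memTorusHardy.memLp.integrable hp
  refine ⟨⟨memLp_flowAverage measurable_kroneckerFlow measurePreserving_kroneckerFlow hKm hK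
    hf.memTorusHardy.memLp hp, fun α hα => ?_⟩, fun α => ?_⟩
  · rw [torusFourierCoeff_flowAverage hK hfi, hf.memTorusHardy.coeff_eq_zero α hα, smul_zero]
  · rw [torusFourierCoeff_flowAverage hK hfi, hf.coeff_eq, frequency_natCast]

/-- Every Bohr lift of `D` yields a Bohr lift of `∑_{n ≤ x} aₙ n^{-s}` whose norm is larger by a
factor of at most `14 log x`. -/
theorem exists_isBohrLift_partialSum {f : InfTorus → X} {D : DirSeries X} {p : ℝ≥0∞}
    (hf : IsBohrLift f D p) (hp : 1 ≤ p) {x : ℝ} (hx : 2 ≤ x) :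
    ∃ g : InfTorus → X, IsBohrLift g (partialSum D x) p ∧
      eLpNorm g p torusHaar ≤ ENNReal.ofReal (14 * Real.log x) * eLpNorm f p torusHaar := by
  set N := ⌊x⌋₊ with hN
  have hN2 : 2 ≤ N := Nat.le_floor (by exact_mod_cast hx)
  have hN2' : (2 : ℝ) ≤ N := by exact_mod_cast hN2
  have hNx : (N : ℝ) ≤ x := Nat.floor_le (by linarith)
  set a := Real.log N
  set b := Real.log (N + 1 : ℝ)
  have ha : 0 ≤ a := Real.log_nonneg (by linarith)
  have hab : a < b := Real.log_lt_log (by linarith) (by linarith)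
  have hba : 0 < b - a := sub_pos.2 hab
  have hbpos : 0 < b := by linarith
  set K : ℝ → ℂ := fun t => (trapezoidKernel a b t : ℂ) with hKdef
  have hKm : Measurable K := Complex.measurable_ofReal.comp (measurable_trapezoidKernel a b)
  have hK : Integrable K := (integrable_trapezoidKernel a b).ofReal
  refine ⟨flowAverage K kroneckerFlow f, ?_, ?_⟩
  · convert! hf.flowAverage hp hKm hK using 1
    funext n
    have hn1 : (1 : ℝ) ≤ (n : ℕ) := by exact_mod_cast one_le (a := n)
    have hlog : 0 ≤ Real.log ((n : ℕ) : ℝ) := Real.log_nonneg hn1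
    have hint := integral_cexp_mul_trapezoidKernel ha hab (Real.log ((n : ℕ) : ℝ))
    simp only [hKdef, hint, abs_of_nonneg hlog, partialSum]
    split_ifs with hnx
    · have h1 : Real.log ((n : ℕ) : ℝ) ≤ a :=
        Real.log_le_log (by linarith) (by exact_mod_cast Nat.le_floor hnx)
      rw [max_eq_right (by linarith), max_eq_right (by linarith), sub_sub_sub_cancel_right,
        div_self hba.ne']
      simp
    · have h1 : b ≤ Real.log ((n : ℕ) : ℝ) := by
        refine Real.log_le_log (by linarith) ?_
        have : N < (n : ℕ) := (Nat.floor_lt (by linarith)).2 (not_le.1 hnx)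
        exact_mod_cast this
      rw [max_eq_left (by linarith), max_eq_left (by linarith)]
      simp
  · refine (eLpNorm_flowAverage_le measurable_kroneckerFlow measurePreserving_kroneckerFlow hKm hK
      hf.memTorusHardy.memLp.1 hp).trans ?_
    gcongr
    rw [← ofReal_integral_norm_eq_lintegral_enorm hK]
    refine ENNReal.ofReal_le_ofReal ?_
    have h1 : ∫ t, ‖K t‖ = ∫ t, |trapezoidKernel a b t| := by
      simp [hKdef]
    rw [h1]
    refine (integral_abs_trapezoidKernel_le ha hab).trans ?_
    have hlogx : 1 / 2 ≤ Real.log x :=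
      (by linarith [Real.log_two_gt_d9] : (1 : ℝ) / 2 ≤ Real.log 2).trans
        (Real.log_le_log (by norm_num) hx)
    -- From log y ≤ y - 1 at y = N/(N+1).
    have hgap : 1 / (N + 1 : ℝ) ≤ b - a := by
      have h2 := Real.log_le_sub_one_of_pos (x := (N : ℝ) / (N + 1)) (by positivity)
      rw [Real.log_div (by positivity) (by positivity)] at h2
      have h3 : (N : ℝ) / (N + 1) - 1 = -(1 / (N + 1 : ℝ)) := by field_simp; ring
      linarith
    have hb : b ≤ N := by
      have := Real.log_le_sub_one_of_pos (x := (N + 1 : ℝ)) (by positivity)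
      linarith
    -- The crude power 4 contributes 4 log x to the final bound; the constant 6 is absorbed by 10
    -- log x, since 10 log 2 > 6. Hence the factor 14.
    have hratio : b / (b - a) ≤ x ^ 4 / 2 := by
      rw [div_le_iff₀ hba]
      have h4 : x ^ 4 / 2 * (1 / (N + 1 : ℝ)) ≤ x ^ 4 / 2 * (b - a) := by gcongr
      refine le_trans ?_ h4
      rw [mul_one_div, le_div_iff₀ (by positivity)]
      have h5 : b * (N + 1) ≤ x * (x + 1) := by gcongr; linarith
      have h6 : x * (x + 1) ≤ x ^ 4 / 2 := by
        have h7 : 4 ≤ x ^ 2 := by nlinarith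
        nlinarith
      linarith
    have h7 : Real.log (b / (b - a)) ≤ 4 * Real.log x - Real.log 2 := by
      have h8 := Real.log_le_log (by positivity) hratio
      rw [Real.log_div (x := x ^ 4) (by positivity) (by norm_num), Real.log_pow] at h8
      exact_mod_cast h8
    have h9 := Real.log_two_gt_d9
    have h10 := Real.log_le_log (by norm_num) hx
    linarith

theorem dirTranslate_partialSum {X : Type*} [NormedAddCommGroup X] [NormedSpace ℂ X] (D : DirSeries X) (x : ℝ) (z : ℂ) :
    dirTranslate (partialSum D x) z = partialSum (dirTranslate D z) x := by
  funext n
  simp only [dirTranslate, partialSum, smul_ite, smul_zero]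

theorem MemH.partialSum {D : DirSeries X} {p : ℝ≥0∞} (hD : MemH D p) (hp : 1 ≤ p) {x : ℝ}
    (hx : 2 ≤ x) : MemH (partialSum D x) p := by
  obtain ⟨f, hf⟩ := hD
  obtain ⟨g, hg, -⟩ := exists_isBohrLift_partialSum hf hp hx
  exact ⟨g, hg⟩

theorem hENorm_partialSum_le (D : DirSeries X) {p : ℝ≥0∞} (hp : 1 ≤ p) {x : ℝ} (hx : 2 ≤ x) :
    hENorm (partialSum D x) p ≤ ENNReal.ofReal (14 * Real.log x) * hENorm D p := by
  have h0 : 0 < 14 * Real.log x := mul_pos (by norm_num) (Real.log_pos (by linarith))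
  simp only [hENorm]
  -- The bound holds lift by lift, so uniqueness of the lift is not needed. Positivity of the factor
  -- matters when there is no lift: the infimum is then ∞ and must stay ∞ after multiplication.
  rw [ENNReal.mul_iInf_of_ne (ENNReal.ofReal_pos.2 h0).ne' ENNReal.ofReal_ne_top]
  refine le_iInf fun f => ?_
  rw [ENNReal.mul_iInf_of_ne (ENNReal.ofReal_pos.2 h0).ne' ENNReal.ofReal_ne_top]
  refine le_iInf fun hf => ?_
  obtain ⟨g, hg, hle⟩ := exists_isBohrLift_partialSum hf hp hx
  exact (iInf₂_le g hg).trans hle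

theorem hPlusENorm_partialSum_le (D : DirSeries X) {p : ℝ≥0∞} (hp : 1 ≤ p) {x : ℝ} (hx : 2 ≤ x) :
    hPlusENorm (partialSum D x) p ≤ ENNReal.ofReal (14 * Real.log x) * hPlusENorm D p := by
  refine iSup₂_le fun ε hε => ?_
  rw [dirTranslate_partialSum]
  refine (hENorm_partialSum_le _ hp hx).trans ?_
  gcongr
  exact le_iSup₂ (f := fun (ε : ℝ) (_ : 0 < ε) => hENorm (dirTranslate D (ε : ℂ)) p) ε hε

end HardyDirichlet

theorem mainTheorem8 :
    ∃ C : ℝ, 0 < C ∧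
      ∀ (X : Type*) [NormedAddCommGroup X] [NormedSpace ℂ X] [CompleteSpace X]
        (p : ℝ≥0∞), 1 ≤ p →
        ∀ D : HardyDirichlet.DirSeries X, HardyDirichlet.MemHPlus D p →
          ∀ x : ℝ, 2 ≤ x →
            HardyDirichlet.MemHPlus (HardyDirichlet.partialSum D x) p ∧
            HardyDirichlet.hPlusNorm (HardyDirichlet.partialSum D x) p ≤
              C * Real.log x * HardyDirichlet.hPlusNorm D p := by
  refine ⟨14, by norm_num, fun X _ _ _ p hp D hD x hx => ?_⟩
  have hle := HardyDirichlet.hPlusENorm_partialSum_le D hp hx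
  -- Finiteness is required before passing to real norms, because `toReal` sends ∞ to 0.
  have hfin : ENNReal.ofReal (14 * Real.log x) * HardyDirichlet.hPlusENorm D p < ∞ :=
    ENNReal.mul_lt_top ENNReal.ofReal_lt_top hD.norm_lt_top
  refine ⟨⟨fun ε hε => ?_, hle.trans_lt hfin⟩, ?_⟩
  · rw [HardyDirichlet.dirTranslate_partialSum]
    exact (hD.translate_mem ε hε).partialSum hp hx
  · have h := ENNReal.toReal_mono hfin.ne hle
    rwa [ENNReal.toReal_mul, ENNReal.toReal_ofReal
      (mul_nonneg (by norm_num) (Real.log_nonneg (by linarith)))] at h
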